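/- Let $K$ be a field and let $P$ be a finite poset with a least element $0_P$ such that for every $z\in P$ the interval $[0_P,z]$ is a distributive lattice (a \emph{locally distributive lattice}). For $z\in P$ let $$T_z = K[[0_P,z]]\,/\,\bigl(xy-(x\wedge y)(x\vee y) : x,y\in[0_P,z]\bigr),$$ the quotient of the polynomial ring on the elements of $[0_P,z]$, with meet and join taken in $[0_P,z]$, and graded by giving every element of $[0_P,z]$ degree $1$. For $z'\le z$ let $T_{z'z}\colon T_z\to T_{z'}$ be the graded $K$-algebra homomorphism sending $x$ to $x$ if $x\le z'$ and to $0$ otherwise. Let $\lim_P T$ be the inverse limit, that is, the $K$-algebra of families $(s_z)_{z\in P}\in\prod_z T_z$ with $T_{z'z}(s_z)=s_{z'}$ for all $z'\le z$, with degree-$d$ part the families all of whose members have degree $d$ ($d\in\mathbb Z$). For $x\in P$ let $\phi(x)\in\lim_P T$ be the family whose member in $T_z$ is the class of $x$ if $x\le z$, and $0$ otherwise. For $m\in\mathbb N^P$ put $\phi(m)=\prod_{x\in P}\phi(x)^{m(x)}$; it is called standard if $\operatorname{supp}(m)$ is a chain. Then: 1. With $\phi$, $\lim_P T$ is a $\mathbb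 Z$-graded algebra with straightening law (ASL) on $P^{\mathrm{op}}$ over $K$. That is, $\phi$ is injective; the degree parts above make $\lim_P T$ a $\mathbb Z$-graded $K$-algebra in which every $\phi(x)$ is homogeneous of positive degree (in fact of degree $1$); the standard monomials form a $K$-basis of $\lim_P T$; and if $x,y\in P$ are incomparable and $\phi(m)$ occurs with non-zero coefficient in the expansion of $\phi(x)\phi(y)$ in standard monomials, then $\operatorname{supp}(m)$ is non-empty and its maximal element $x_m$ satisfies $x<x_m$ and $y<x_m$. 2. The $K$-algebra homomorphism $K[P]\to\lim_P T$, $x\mapsto\phi(x)$, from the polynomial ring on the elements of $P$ is surjective, and its kernel $I_T$ is generated by the elements $$xy-(x\wedge y)\sum_z z\qquad(x,y\in P),$$ where $z$ ranges over all minimal upper bounds of $x$ and $y$ in $P$. The second term is zero if there are none; if there is one, then the meet $x\wedge y$ exists in $P$. 3. If $P$ is a simplicial poset, i.e. every interval $[0_P,z]$ is a Boolean algebra, let $\tilde A_P$ be Stanley's ring, the quotient of $K[P]$ by the ideal generated by $xy$ for all $x,y$ without a common upper bound and by $xy-(x\wedge y)\sum_z z$, with $z$ ranging over the minimal upper bounds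 of $x,y$, for all $x,y$ with a common upper bound. Then $\tilde A_P$ is an ASL on $P^{\mathrm{op}}$ with respect to the classes of the elements $x\in P$, and there is an isomorphism of $K$-algebras $\lim_P T\cong\tilde A_P$ sending $\phi(x)$ to the class of $x$ for every $x\in P$. -/

import Mathlib

noncomputable section

namespace GenHibi

open MvPolynomial

/-! ### Graded algebras over a finite poset and their rings of global sections -/

/-- A `ℤ`-graded `KP`-algebra: `ℤ`-graded `K`-algebras `T_x` for `x ∈ P` and graded
`K`-algebra homomorphisms `T_{xy} : T_y → T_x` for `x ≤ y`, functorial in the pair. -/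
structure PosetAlgebra (K : Type*) [Field K] (P : Type*) [PartialOrder P] where
  stalk : P → Type*
  [commRing : ∀ x, CommRing (stalk x)]
  [algebra : ∀ x, Algebra K (stalk x)]
  /-- `grading x d` is the homogeneous part of degree `d` of the stalk at `x`. -/
  grading : ∀ x, ℤ → Submodule K (stalk x)
  graded : ∀ x, Nonempty (GradedAlgebra (grading x))
  /-- The restriction homomorphism `T_{xy} : T_y → T_x`. -/
  res : ∀ {x y : P}, x ≤ y → (stalk y →ₐ[K] stalk x)
  res_mem : ∀ {x y : P} (h : x ≤ y) (d : ℤ) (s : stalk y), s ∈ grading y d → res h s ∈ grading x d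
  res_refl : ∀ x : P, res (le_refl x) = AlgHom.id K (stalk x)
  res_comp : ∀ {x y z : P} (h : x ≤ y) (h' : y ≤ z), (res h).comp (res h') = res (h.trans h')

attribute [instance] PosetAlgebra.commRing PosetAlgebra.algebra

/-- The inverse limit `lim_P T`: compatible families of elements of the stalks. -/
def PosetAlgebra.lim {K : Type*} [Field K] {P : Type*} [PartialOrder P] (T : PosetAlgebra K P) :
    Subalgebra K (∀ x, T.stalk x) where
  carrier := {s | ∀ (x y : P) (h : x ≤ y), T.res h (s y) = s x}
  mul_mem' := fun ha hb x y h => by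
    rw [Pi.mul_apply, Pi.mul_apply, map_mul, ha x y h, hb x y h]
  add_mem' := fun ha hb x y h => by
    rw [Pi.add_apply, Pi.add_apply, map_add, ha x y h, hb x y h]
  algebraMap_mem' := fun r x y h => by
    rw [Pi.algebraMap_apply, Pi.algebraMap_apply, AlgHom.commutes]

/-- The part of degree `d` of `lim_P T`: the families all of whose members have degree `d`. -/
def PosetAlgebra.limGrading {K : Type*} [Field K] {P : Type*} [PartialOrder P]
    (T : PosetAlgebra K P) (d : ℤ) : Submodule K T.lim where
  carrier := {s | ∀ x, s.1 x ∈ T.grading x d}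
  add_mem' := fun ha hb x => (T.grading x d).add_mem (ha x) (hb x)
  zero_mem' := fun x => (T.grading x d).zero_mem
  smul_mem' := fun c _ ha x => (T.grading x d).smul_mem c (ha x)

/-! ### Algebras with straightening law -/

/-- The monomial `φ(m) = ∏ φ(x) ^ m(x)` of `R` attached to `m ∈ ℕ^P`. -/
def monomialOf {P R : Type*} [CommRing R] (φ : P → R) (m : P →₀ ℕ) : R :=
  m.prod fun x k => φ x ^ k

/-- The standard monomials on `P`: those whose support is a chain. -/
abbrev StdMonomial (P : Type*) [PartialOrder P] : Type _ :=
  {m : P →₀ ℕ // IsChain (· ≤ ·) (m.support : Set P)}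

/-- `R`, with `φ : P → R`, is an algebra with straightening law on `P^op` over `K`. -/
structure IsASLOnOp (K : Type*) [Field K] {P : Type*} [PartialOrder P] {R : Type*} [CommRing R]
    [Algebra K R] (φ : P → R) : Prop where
  injective : Function.Injective φ
  /-- The standard monomials are linearly independent ... -/
  linearIndependent : LinearIndependent K fun m : StdMonomial P => monomialOf φ m.1
  /-- ... and span `R`, so that they are a `K`-basis. -/
  span_eq_top : Submodule.span K (Set.range fun m : StdMonomial P => monomialOf φ m.1) = ⊤
  /-- If `x, y` are incomparable and `xy = ∑ r_m φ(m)` is written in standard monomials, then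
  `r_m ≠ 0` implies that the maximal element `w` of the support of `m` satisfies `x, y < w`. -/
  straightening : ∀ x y : P, ¬ x ≤ y → ¬ y ≤ x → ∀ r : StdMonomial P →₀ K,
    φ x * φ y = r.sum (fun m c => c • monomialOf φ m.1) →
    ∀ m, r m ≠ 0 → ∃ w, IsGreatest (m.1.support : Set P) w ∧ x < w ∧ y < w

/-- `R` is a `ℤ`-graded ASL on `P^op`: an ASL with a grading of the `K`-algebra `R` in which every
element of `P` is homogeneous of positive degree. -/
structure IsGradedASLOnOp (K : Type*) [Field K] {P : Type*} [PartialOrder P] {R : Type*}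
    [CommRing R] [Algebra K R] (𝒜 : ℤ → Submodule K R) (φ : P → R) : Prop where
  isASL : IsASLOnOp K φ
  graded : Nonempty (GradedAlgebra 𝒜)
  pos_degree : ∀ x, ∃ d : ℤ, 0 < d ∧ φ x ∈ 𝒜 d

/-! ### Locally distributive lattices and simplicial posets -/

/-- Every interval `[0_P, z]`, with the order induced from `P`, is a distributive lattice. -/
def IsLocallyDistributive (P : Type*) [PartialOrder P] [OrderBot P] : Prop :=
  ∀ z : P, ∃ L : DistribLattice (Set.Icc ⊥ z), ∀ a b, L.le a b ↔ (a : P) ≤ (b : P)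

/-- Every interval `[0_P, z]`, with the order induced from `P`, is a Boolean algebra. -/
def IsSimplicialPoset (P : Type*) [PartialOrder P] [OrderBot P] : Prop :=
  ∀ z : P, ∃ L : BooleanAlgebra (Set.Icc ⊥ z), ∀ a b, L.le a b ↔ (a : P) ≤ (b : P)

/-! ### Hibi rings -/

/-- The ideal of `K[L]` generated by all `x y - (x ∧ y) (x ∨ y)`. -/
def hibiIdeal (K : Type*) [Field K] (L : Type*) [PartialOrder L] : Ideal (MvPolynomial L K) :=
  Ideal.span {f | ∃ x y m j : L, IsGLB {x, y} m ∧ IsLUB {x, y} j ∧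
    f = X x * X y - X m * X j}

/-- The Hibi ring `K[L] / (x y - (x ∧ y) (x ∨ y))` of a lattice `L`. -/
abbrev HibiRing (K : Type*) [Field K] (L : Type*) [PartialOrder L] : Type _ :=
  MvPolynomial L K ⧸ hibiIdeal K L

/-- The standard grading of the Hibi ring: every element of `L` has degree `1`. -/
def hibiGrading (K : Type*) [Field K] (L : Type*) [PartialOrder L] (d : ℤ) :
    Submodule K (HibiRing K L) :=
  (weightedHomogeneousSubmodule K (fun _ : L => (1 : ℤ)) d).map
    (Ideal.Quotient.mkₐ K (hibiIdeal K L)).toLinearMap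

theorem hibiIdeal_component_mem (K : Type*) [Field K] (L : Type*) [PartialOrder L]
    {f : MvPolynomial L K} (hf : f ∈ hibiIdeal K L) (d : ℤ) :
    weightedHomogeneousComponent (fun _ : L => (1 : ℤ)) d f ∈ hibiIdeal K L := by
  let _ : GradedAlgebra (weightedHomogeneousSubmodule K (fun _ : L => (1 : ℤ))) :=
    weightedGradedAlgebra K _
  refine weightedHomogeneousComponent_mem_of_mem K _ ?_ hf d
  refine Ideal.homogeneous_span _ _ ?_
  rintro _ ⟨x, y, m, j, -, -, rfl⟩
  exact ⟨1 + 1, ((isWeightedHomogeneous_X K _ x).mul (isWeightedHomogeneous_X K _ y)).sub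
    ((isWeightedHomogeneous_X K _ m).mul (isWeightedHomogeneous_X K _ j))⟩

theorem hibiGrading_graded (K : Type*) [Field K] (L : Type*) [PartialOrder L] :
    Nonempty (GradedAlgebra (hibiGrading K L)) := by
  classical
  let : GradedAlgebra (weightedHomogeneousSubmodule K (fun _ : L => (1 : ℤ))) :=
    weightedGradedAlgebra K _
  have hm : SetLike.GradedMonoid (hibiGrading K L) :=
    { one_mem := ⟨1, isWeightedHomogeneous_one K _, map_one (Ideal.Quotient.mk (hibiIdeal K L))⟩
      mul_mem := by
        rintro i j _ _ ⟨f, hf, rfl⟩ ⟨g, hg, rfl⟩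
        exact ⟨f * g, IsWeightedHomogeneous.mul hf hg,
          map_mul (Ideal.Quotient.mk (hibiIdeal K L)) _ _⟩ }
  have hint : DirectSum.IsInternal (hibiGrading K L) := by
    have hπ : ∀ d : ℤ, ∃ π : HibiRing K L →ₗ[K] HibiRing K L, ∀ f,
        π (Ideal.Quotient.mk _ f) =
          Ideal.Quotient.mk _ (weightedHomogeneousComponent (fun _ : L => (1 : ℤ)) d f) := by
      intro d
      refine ⟨((hibiIdeal K L).restrictScalars K).mapQ ((hibiIdeal K L).restrictScalars K)
        (weightedHomogeneousComponent (fun _ : L => (1 : ℤ)) d)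
        (fun f hf => hibiIdeal_component_mem K L hf d), fun f => rfl⟩
    choose π hπ using hπ
    rw [DirectSum.isInternal_submodule_iff_iSupIndep_and_iSup_eq_top]
    constructor
    · intro d
      rw [Submodule.disjoint_def]
      rintro a ⟨f, hf, rfl⟩ ha
      have h1 : π d (Ideal.Quotient.mk _ f) = Ideal.Quotient.mk _ f := by
        rw [hπ, IsWeightedHomogeneous.weightedHomogeneousComponent_same hf]
      have h2 : (⨆ (e) (_ : e ≠ d), hibiGrading K L e) ≤ LinearMap.ker (π d) := by
        refine iSup₂_le fun e he => ?_
        rintro _ ⟨g, hg, rfl⟩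
        change π d (Ideal.Quotient.mk _ g) = 0
        rw [hπ, IsWeightedHomogeneous.weightedHomogeneousComponent_ne _ hg he.symm, map_zero]
      exact h1.symm.trans (h2 ha)
    · rw [eq_top_iff]
      rintro a -
      obtain ⟨f, rfl⟩ := Ideal.Quotient.mk_surjective a
      induction f using MvPolynomial.induction_on' with
      | monomial u c =>
        exact Submodule.mem_iSup_of_mem _
          ⟨monomial u c, isWeightedHomogeneous_monomial _ u c rfl, rfl⟩
      | add p q hp hq => rw [map_add]; exact Submodule.add_mem _ hp hq
  let := hint.chooseDecomposition
  exact ⟨{ hm, hint.chooseDecomposition with }⟩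

open Classical in
/-- The projection `K[[0_P, z]] → K[[0_P, z']]` that keeps the variables `x ≤ z'` and sends the
others to `0`. -/
def polyProj (K : Type*) [Field K] {P : Type*} [PartialOrder P] [OrderBot P] (z' z : P) :
    MvPolynomial (Set.Icc ⊥ z) K →ₐ[K] MvPolynomial (Set.Icc ⊥ z') K :=
  aeval fun x => if h : x.1 ≤ z' then X ⟨x.1, Set.mem_Icc.2 ⟨bot_le, h⟩⟩ else 0

theorem polyProj_X_pos (K : Type*) [Field K] {P : Type*} [PartialOrder P] [OrderBot P] {z' z : P}
    (x : Set.Icc ⊥ z) (h : x.1 ≤ z') : polyProj K z' z (X x) = X ⟨x.1, Set.mem_Icc.2 ⟨bot_le, h⟩⟩ := by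
  simp [polyProj, h]

theorem polyProj_X_neg (K : Type*) [Field K] {P : Type*} [PartialOrder P] [OrderBot P] {z' z : P}
    (x : Set.Icc ⊥ z) (h : ¬ x.1 ≤ z') : polyProj K z' z (X x) = 0 := by
  simp [polyProj, h]

theorem polyProj_mem (K : Type*) [Field K] {P : Type*} [PartialOrder P] [OrderBot P] {z' z : P}
    (hz : z' ≤ z) (f : MvPolynomial (Set.Icc ⊥ z) K) (hf : f ∈ hibiIdeal K (Set.Icc ⊥ z)) :
    polyProj K z' z f ∈ hibiIdeal K (Set.Icc ⊥ z') := by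
  suffices h : hibiIdeal K (Set.Icc ⊥ z) ≤
      (hibiIdeal K (Set.Icc ⊥ z')).comap (polyProj K z' z) from h hf
  refine Ideal.span_le.2 ?_
  rintro _ ⟨x, y, m, j, hm, hj, rfl⟩
  change polyProj K z' z _ ∈ hibiIdeal K (Set.Icc ⊥ z')
  have hxj : x ≤ j := hj.1 (by simp)
  have hyj : y ≤ j := hj.1 (by simp)
  have hmx : m ≤ x := hm.1 (by simp)
  have hmy : m ≤ y := hm.1 (by simp)
  rw [map_sub, map_mul, map_mul]
  by_cases hx : x.1 ≤ z'
  · by_cases hy : y.1 ≤ z'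
    · have hjz : j.1 ≤ z' := by
        have : j ≤ ⟨z', Set.mem_Icc.2 ⟨bot_le, hz⟩⟩ := hj.2 (by
          rintro w (rfl | rfl)
          · exact hx
          · exact hy)
        exact this
      have hmz : m.1 ≤ z' := le_trans hmx hx
      rw [polyProj_X_pos K x hx, polyProj_X_pos K y hy, polyProj_X_pos K m hmz,
        polyProj_X_pos K j hjz]
      refine Ideal.subset_span ⟨_, _, _, _, ⟨?_, ?_⟩, ⟨?_, ?_⟩, rfl⟩
      · rintro w (rfl | rfl)
        · exact hmx
        · exact hmy
      · intro w hw
        have h1 : w.1 ≤ x.1 := hw (Set.mem_insert _ _)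
        have h2 : w.1 ≤ y.1 := hw (Set.mem_insert_of_mem _ rfl)
        have : (⟨w.1, Set.mem_Icc.2 ⟨bot_le, w.2.2.trans hz⟩⟩ : Set.Icc ⊥ z) ≤ m := hm.2 (by
          rintro v (rfl | rfl)
          · exact h1
          · exact h2)
        exact this
      · rintro w (rfl | rfl)
        · exact hxj
        · exact hyj
      · intro w hw
        have h1 : x.1 ≤ w.1 := hw (Set.mem_insert _ _)
        have h2 : y.1 ≤ w.1 := hw (Set.mem_insert_of_mem _ rfl)
        have : j ≤ (⟨w.1, Set.mem_Icc.2 ⟨bot_le, w.2.2.trans hz⟩⟩ : Set.Icc ⊥ z) := hj.2 (by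
          rintro v (rfl | rfl)
          · exact h1
          · exact h2)
        exact this
    · rw [polyProj_X_neg K y hy, polyProj_X_neg K j fun h => hy (le_trans hyj h)]
      simp
  · rw [polyProj_X_neg K x hx, polyProj_X_neg K j fun h => hx (le_trans hxj h)]
    simp

/-- The restriction `T_{z'z} : T_z → T_{z'}` induced by `polyProj`. -/
def hibiRes (K : Type*) [Field K] {P : Type*} [PartialOrder P] [OrderBot P] {z' z : P}
    (hz : z' ≤ z) : HibiRing K (Set.Icc ⊥ z) →ₐ[K] HibiRing K (Set.Icc ⊥ z') :=
  Ideal.quotientMapₐ (hibiIdeal K (Set.Icc ⊥ z')) (polyProj K z' z) (polyProj_mem K hz)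

theorem hibiRes_mk (K : Type*) [Field K] {P : Type*} [PartialOrder P] [OrderBot P] {z' z : P}
    (hz : z' ≤ z) (f : MvPolynomial (Set.Icc ⊥ z) K) :
    hibiRes K hz (Ideal.Quotient.mk _ f) = Ideal.Quotient.mk _ (polyProj K z' z f) := rfl

theorem polyProj_homogeneous (K : Type*) [Field K] {P : Type*} [PartialOrder P] [OrderBot P]
    (z' z : P) (d : ℤ) (f : MvPolynomial (Set.Icc ⊥ z) K)
    (hf : IsWeightedHomogeneous (fun _ => (1 : ℤ)) f d) :
    IsWeightedHomogeneous (fun _ => (1 : ℤ)) (polyProj K z' z f) d := by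
  classical
  rw [f.as_sum, map_sum]
  refine IsWeightedHomogeneous.sum _ _ _ fun u hu => ?_
  have hd := hf (mem_support_iff.1 hu)
  rw [polyProj, aeval_monomial, algebraMap_eq]
  refine IsWeightedHomogeneous.C_mul ?_ _
  have := IsWeightedHomogeneous.prod (R := K) (w := fun _ : Set.Icc ⊥ z' => (1 : ℤ)) u.support
    (fun x => (if h : x.1 ≤ z' then X ⟨x.1, Set.mem_Icc.2 ⟨bot_le, h⟩⟩ else 0) ^ u x) (fun x => u x • (1 : ℤ))
    (fun x _ => by
      refine IsWeightedHomogeneous.pow ?_ _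
      split_ifs with h
      · exact isWeightedHomogeneous_X K _ _
      · exact isWeightedHomogeneous_zero K _ _)
  rw [← hd, Finsupp.weight_apply]
  exact this

/-- The `ℤ`-graded `KP`-algebra `T` with stalks the Hibi rings of the intervals `[0_P, z]`. -/
def hibiAlgebra (K : Type*) [Field K] (P : Type*) [PartialOrder P] [OrderBot P] :
    PosetAlgebra K P where
  stalk z := HibiRing K (Set.Icc ⊥ z)
  grading z := hibiGrading K (Set.Icc ⊥ z)
  graded z := hibiGrading_graded K (Set.Icc ⊥ z)
  res hz := hibiRes K hz
  res_mem := by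
    rintro x y h d _ ⟨f, hf, rfl⟩
    exact ⟨polyProj K x y f, polyProj_homogeneous K x y d f hf, rfl⟩
  res_refl z := by
    refine Ideal.Quotient.algHom_ext _ (MvPolynomial.algHom_ext fun x => ?_)
    change hibiRes K (le_refl z) (Ideal.Quotient.mk _ (X x)) = Ideal.Quotient.mk _ (X x)
    rw [hibiRes_mk, polyProj_X_pos K x x.2.2]
  res_comp := by
    intro x y z h h'
    refine Ideal.Quotient.algHom_ext _ (MvPolynomial.algHom_ext fun w => ?_)
    change hibiRes K h (hibiRes K h' (Ideal.Quotient.mk _ (X w))) =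
      hibiRes K (h.trans h') (Ideal.Quotient.mk _ (X w))
    rw [hibiRes_mk, hibiRes_mk, hibiRes_mk]
    by_cases hy : w.1 ≤ y
    · rw [polyProj_X_pos K w hy]
      by_cases hx : w.1 ≤ x
      · rw [polyProj_X_pos K w hx, polyProj_X_pos K ⟨w.1, Set.mem_Icc.2 ⟨bot_le, hy⟩⟩ hx]
      · rw [polyProj_X_neg K w hx, polyProj_X_neg K ⟨w.1, Set.mem_Icc.2 ⟨bot_le, hy⟩⟩ hx]
    · rw [polyProj_X_neg K w hy, polyProj_X_neg K w fun hx => hy (hx.trans h), map_zero]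

/-- The generalized Hibi ring `lim_P T`. -/
abbrev GenHibiRing (K : Type*) [Field K] (P : Type*) [PartialOrder P] [OrderBot P] : Type _ :=
  (hibiAlgebra K P).lim

open Classical in
/-- The family attached to `x ∈ P`: its member in `T_z` is the class of the variable `x` if
`x ≤ z`, and `0` otherwise. -/
def genFamily (K : Type*) [Field K] {P : Type*} [PartialOrder P] [OrderBot P] (x z : P) :
    HibiRing K (Set.Icc ⊥ z) :=
  if h : x ≤ z then Ideal.Quotient.mk _ (X ⟨x, Set.mem_Icc.2 ⟨bot_le, h⟩⟩) else 0

/-- The element of `lim_P T` given by `x ∈ P`. -/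
def gen (K : Type*) [Field K] {P : Type*} [PartialOrder P] [OrderBot P] (x : P) :
    GenHibiRing K P :=
  ⟨fun z => genFamily K x z, by
    intro z' z hz
    change hibiRes K hz (genFamily K x z) = genFamily K x z'
    by_cases h : x ≤ z'
    · rw [genFamily, genFamily, dif_pos (h.trans hz), dif_pos h, hibiRes_mk,
        polyProj_X_pos K _ h]
    · by_cases h' : x ≤ z
      · rw [genFamily, genFamily, dif_pos h', dif_neg h, hibiRes_mk, polyProj_X_neg K _ h, map_zero]
      · rw [genFamily, genFamily, dif_neg h', dif_neg h, map_zero]⟩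

/-! ### The relations -/

open Classical in
/-- The set of minimal upper bounds of `x` and `y` in the finite poset `P`. -/
def minUpperBounds {P : Type*} [PartialOrder P] [Fintype P] (x y : P) : Finset P :=
  Finset.univ.filter fun z => Minimal (fun w => x ≤ w ∧ y ≤ w) z

open Classical in
/-- The meet `x ∧ y` in `P`. In a locally distributive lattice it exists whenever `x` and `y` have
a common upper bound; where it does not exist, the value `0_P` is only ever multiplied by an
empty sum. -/
def meet {P : Type*} [PartialOrder P] [OrderBot P] (x y : P) : P :=
  if h : ∃ m, IsGLB {x, y} m then h.choose else ⊥

/-- `x y - (x ∧ y) ∑ z`, the sum being over all minimal upper bounds `z` of `x, y`. -/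
def relation (K : Type*) [Field K] {P : Type*} [PartialOrder P] [OrderBot P] [Fintype P]
    (x y : P) : MvPolynomial P K :=
  X x * X y - X (meet x y) * ∑ z ∈ minUpperBounds x y, X z

/-- Stanley's ideal of a simplicial poset: generated by the products `x y` where `x, y` have no
common upper bound, and by `x y - (x ∧ y) ∑ z`, with `z` running over the minimal upper bounds of
`x, y`, where they have one. -/
def stanleyIdeal (K : Type*) [Field K] (P : Type*) [PartialOrder P] [Fintype P] :
    Ideal (MvPolynomial P K) :=
  Ideal.span ({f | ∃ x y : P, ¬ BddAbove {x, y} ∧ f = X x * X y} ∪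
    {f | ∃ x y m : P, BddAbove {x, y} ∧ IsGLB {x, y} m ∧
      f = X x * X y - X m * ∑ z ∈ minUpperBounds x y, X z})

/-- Stanley's ring `Ã_P` of a simplicial poset (the variable `0_P` is not set to `1`). -/
abbrev StanleyRing (K : Type*) [Field K] (P : Type*) [PartialOrder P] [Fintype P] : Type _ :=
  MvPolynomial P K ⧸ stanleyIdeal K P

end GenHibi

end

/-!
In any algebra satisfying the relations `x y = (x ∧ y) ∑ z`, the product of incomparable elements
is a combination of products `a w` with `a ≤ w` and `w` larger than both, so that repeated
straightening writes every monomial in terms of the standard ones. For a distributive lattice `L`,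
represented by sets `e x` of prime ideals, `x ↦ t ∏_{p ∈ e x} X_p` maps the Hibi ring of `L` to a
polynomial ring and takes distinct standard monomials to distinct monomials. Hence the standard
monomials with support in `[0_P, z]` form a basis of `T_z`, and the others restrict to `0` there.

The coefficient of a standard monomial in the expansion of a section over `T_z` does not depend on
`z`, so these coefficients glue to an expansion in `lim_P T`, unique because it is so in the stalks.
As the standard monomials also span `K[P] / I_T`, where the relations hold by construction,
and are independent in `lim_P T`, the map `K[P] / I_T → lim_P T` is injective.
-/

namespace GenHibi

open MvPolynomial

section Monomials

variable {P R S : Type*} [CommRing R] [CommRing S]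

theorem monomialOf_single (φ : P → R) (x : P) : monomialOf φ (Finsupp.single x 1) = φ x := by
  simp [monomialOf]

theorem monomialOf_add (φ : P → R) (m n : P →₀ ℕ) :
    monomialOf φ (m + n) = monomialOf φ m * monomialOf φ n := by
  classical
  exact Finsupp.prod_add_index' (fun _ => pow_zero _) fun _ _ _ => pow_add _ _ _

theorem monomialOf_single_add_single (φ : P → R) (x y : P) :
    monomialOf φ (Finsupp.single x 1 + Finsupp.single y 1) = φ x * φ y := by
  rw [monomialOf_add, monomialOf_single, monomialOf_single]

theorem monomialOf_mapDomain {Q : Type*} (φ : P → R) (g : Q → P) (m : Q →₀ ℕ) :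
    monomialOf φ (m.mapDomain g) = monomialOf (φ ∘ g) m :=
  Finsupp.prod_mapDomain_index (fun _ => pow_zero _) fun _ _ _ => pow_add _ _ _

theorem monomialOf_eq_zero {φ : P → R} {m : P →₀ ℕ} {x : P} (hx : x ∈ m.support) (h : φ x = 0) :
    monomialOf φ m = 0 :=
  Finset.prod_eq_zero hx <| by
    simp only [h, zero_pow (Finsupp.mem_support_iff.1 hx)]

theorem map_monomialOf {F : Type*} [FunLike F R S] [RingHomClass F R S] (f : F) (φ : P → R)
    (m : P →₀ ℕ) : f (monomialOf φ m) = monomialOf (fun x => f (φ x)) m := by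
  simp only [monomialOf, Finsupp.prod, map_prod, map_pow]

theorem aeval_monomial_one {K : Type*} [CommSemiring K] [Algebra K R] (φ : P → R) (m : P →₀ ℕ) :
    aeval φ (monomial m (1 : K)) = monomialOf φ m := by
  rw [aeval_monomial, map_one, one_mul, monomialOf]

theorem support_single_add_single_one [DecidableEq P] (x y : P) :
    (Finsupp.single x 1 + Finsupp.single y 1 : P →₀ ℕ).support = {x, y} := by
  ext u
  by_cases h1 : x = u <;> by_cases h2 : y = u <;> simp [h1, h2, eq_comm (a := u)]

theorem exists_eq_add_single_one {m : P →₀ ℕ} {x : P} (hx : x ∈ m.support) :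
    ∃ m', m = m' + Finsupp.single x 1 :=
  ⟨_, (tsub_add_cancel_of_le
    (Finsupp.single_le_iff.2 (Nat.one_le_iff_ne_zero.2 (Finsupp.mem_support_iff.1 hx)))).symm⟩

end Monomials

namespace StdMonomial

variable {P : Type*} [PartialOrder P]

theorem exists_isGreatest {m : P →₀ ℕ} (hm : IsChain (· ≤ ·) (m.support : Set P)) (h0 : m ≠ 0) :
    ∃ w, IsGreatest (m.support : Set P) w := by
  obtain ⟨w, hw⟩ := m.support.exists_maximal (Finsupp.support_nonempty_iff.2 h0)
  exact ⟨w, hw.1, fun x hx => (hm.total hx hw.1).elim id fun h => hw.2 hx h⟩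

theorem exists_isLUB [OrderBot P] (m : StdMonomial P) : ∃ t, IsLUB (m.1.support : Set P) t := by
  by_cases h : m.1 = 0
  · exact ⟨⊥, by simp [h]⟩
  · obtain ⟨w, hw⟩ := exists_isGreatest m.2 h
    exact ⟨w, hw.isLUB⟩

/-- The supremum of the chain supporting a standard monomial: its greatest element, or `0_P` for
the monomial `1`. -/
noncomputable def sup [OrderBot P] (m : StdMonomial P) : P := m.exists_isLUB.choose

theorem sup_le_iff [OrderBot P] (m : StdMonomial P) {z : P} :
    m.sup ≤ z ↔ ∀ x ∈ m.1.support, x ≤ z :=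
  isLUB_le_iff m.exists_isLUB.choose_spec

/-- The standard monomial `x`. -/
noncomputable def of (x : P) : StdMonomial P :=
  ⟨Finsupp.single x 1, by
    rw [Finsupp.support_single _ one_ne_zero, Finset.coe_singleton]
    exact Set.subsingleton_singleton.isChain⟩

theorem of_injective : Function.Injective (of : P → StdMonomial P) := fun _ _ h =>
  Finsupp.single_left_injective one_ne_zero (congrArg Subtype.val h)

/-- The standard monomial `a w`, where `a ≤ w`. -/
noncomputable def pair {a w : P} (h : a ≤ w) : StdMonomial P :=
  ⟨Finsupp.single a 1 + Finsupp.single w 1, by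
    classical
    rw [support_single_add_single_one, Finset.coe_pair]
    exact IsChain.pair h⟩

theorem isGreatest_support_pair {a w : P} (h : a ≤ w) :
    IsGreatest ((pair h).1.support : Set P) w := by
  classical
  rw [pair, support_single_add_single_one, Finset.coe_pair]
  exact ⟨Set.mem_insert_of_mem _ rfl, by rintro _ (rfl | rfl); exacts [h, le_rfl]⟩

section Map

variable {Q : Type*} [PartialOrder Q]

/-- The standard monomial on `P` obtained from one on `Q` by an order embedding of `Q` in `P`. -/
noncomputable def map (e : Q ↪o P) (m : StdMonomial Q) : StdMonomial P :=
  ⟨m.1.mapDomain e, by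
    classical
    rw [Finsupp.mapDomain_support_of_injective e.injective, Finset.coe_image]
    exact m.2.image e⟩

theorem map_injective (e : Q ↪o P) : Function.Injective (map e) := fun _ _ h =>
  Subtype.ext (Finsupp.mapDomain_injective e.injective (congrArg Subtype.val h))

theorem mem_range_map_iff (e : Q ↪o P) {m : StdMonomial P} :
    m ∈ Set.range (map e) ↔ (m.1.support : Set P) ⊆ Set.range e := by
  classical
  constructor
  · rintro ⟨n, rfl⟩
    rw [map, Finsupp.mapDomain_support_of_injective e.injective, Finset.coe_image]
    exact Set.image_subset_range _ _
  · refine fun h => ⟨⟨m.1.comapDomain e e.injective.injOn, ?_⟩, Subtype.ext ?_⟩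
    · rw [Finsupp.comapDomain_support, Finset.coe_preimage]
      exact m.2.preimage_relEmbedding e
    · exact Finsupp.mapDomain_comapDomain _ e.injective _ h

end Map

end StdMonomial

section Straightening

/-- Replacing `x y` by `a w` lowers the weight, however small `a` is; hence straightening
terminates. -/
theorem exists_straightening_weight (P : Type*) [PartialOrder P] [Finite P] :
    ∃ ψ : P → ℕ, ∀ a {x y w : P}, x < w → y < w → ψ a + ψ w < ψ x + ψ y := by
  let N := Nat.card P
  let h : P → ℕ := fun x => (Set.Iio x).ncard
  have hle : ∀ x, 2 ^ h x ≤ 2 ^ N := fun x =>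
    Nat.pow_le_pow_right two_pos (Set.ncard_le_card _)
  have hlt : ∀ {x w}, x < w → 2 ^ h x * 2 ≤ 2 ^ h w := fun hxw => by
    rw [← pow_succ]
    exact Nat.pow_le_pow_right two_pos (Set.ncard_lt_ncard (Set.Iio_ssubset_Iio hxw))
  refine ⟨fun x => 2 ^ N - 2 ^ h x, fun a x y w hx hy => ?_⟩
  have := hlt hx; have := hlt hy; have := hle a; have := hle w; have := Nat.two_pow_pos (h a)
  dsimp only
  omega

variable {P : Type*} [PartialOrder P]

/-- Products of incomparable elements are linear combinations of standard products `a w` with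
`a ≤ w`, in which `w` is larger than both factors: the straightening law in degree two, without
any assumption of linear independence. -/
def HasQuadraticStraightening (K : Type*) [CommSemiring K] {R : Type*} [CommRing R] [Algebra K R]
    (φ : P → R) : Prop :=
  ∀ x y : P, ¬ x ≤ y → ¬ y ≤ x →
    φ x * φ y ∈ Submodule.span K {r | ∃ a w, a ≤ w ∧ x < w ∧ y < w ∧ r = φ a * φ w}

namespace HasQuadraticStraightening

variable {R : Type*} [CommRing R]

section CommSemiring

variable {K : Type*} [CommSemiring K] [Algebra K R] {φ : P → R}

theorem monomialOf_mem_span [Finite P] (hφ : HasQuadraticStraightening K φ) (m : P →₀ ℕ) :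
    monomialOf φ m ∈ Submodule.span K (Set.range fun m : StdMonomial P => monomialOf φ m.1) := by
  obtain ⟨ψ, hψ⟩ := exists_straightening_weight P
  induction hn : Finsupp.weight ψ m using Nat.strong_induction_on generalizing m with
  | _ n ih =>
  by_cases hm : IsChain (· ≤ ·) (m.support : Set P)
  · exact Submodule.subset_span ⟨⟨m, hm⟩, rfl⟩
  obtain ⟨x, hx, y, hy, hxy, hyx⟩ : ∃ x ∈ m.support, ∃ y ∈ m.support, ¬ x ≤ y ∧ ¬ y ≤ x := by
    simp only [IsChain, Set.Pairwise, Finset.mem_coe] at hm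
    grind
  obtain ⟨m', rfl⟩ := exists_eq_add_single_one hx
  have hy' : y ∈ m'.support := by
    have hne : x ≠ y := fun h => hxy h.le
    simpa [hne] using hy
  obtain ⟨m', rfl⟩ := exists_eq_add_single_one hy'
  have hstep : Submodule.span K {r | ∃ a w, a ≤ w ∧ x < w ∧ y < w ∧ r = φ a * φ w} ≤
      (Submodule.span K (Set.range fun m : StdMonomial P => monomialOf φ m.1)).comap
        (LinearMap.mulLeft K (monomialOf φ m')) := by
    refine Submodule.span_le.2 ?_
    rintro _ ⟨a, w, -, hxw, hyw, rfl⟩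
    rw [SetLike.mem_coe, Submodule.mem_comap, LinearMap.mulLeft_apply,
      ← monomialOf_single_add_single, ← monomialOf_add]
    refine ih _ ?_ _ rfl
    have := hψ a hxw hyw
    simp only [← hn, map_add, Finsupp.weight_single, one_smul]
    omega
  rw [add_assoc, add_comm (Finsupp.single y 1), monomialOf_add, monomialOf_single_add_single]
  exact hstep (hφ x y hxy hyx)

theorem aeval_mem_span [Finite P] (hφ : HasQuadraticStraightening K φ) (f : MvPolynomial P K) :
    aeval φ f ∈ Submodule.span K (Set.range fun m : StdMonomial P => monomialOf φ m.1) := by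
  induction f using MvPolynomial.induction_on' with
  | monomial m c =>
    rw [← mul_one c, ← smul_eq_mul, ← smul_monomial, map_smul, aeval_monomial_one]
    exact Submodule.smul_mem _ _ (hφ.monomialOf_mem_span m)
  | add p q hp hq => rw [map_add]; exact Submodule.add_mem _ hp hq

theorem span_eq_top [Finite P] (hφ : HasQuadraticStraightening K φ)
    (hsurj : Function.Surjective (aeval φ : MvPolynomial P K →ₐ[K] R)) :
    Submodule.span K (Set.range fun m : StdMonomial P => monomialOf φ m.1) = ⊤ :=
  eq_top_iff.2 fun s _ => by
    obtain ⟨f, rfl⟩ := hsurj s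
    exact hφ.aeval_mem_span f

theorem mul_mem_span_isGreatest (hφ : HasQuadraticStraightening K φ) {x y : P} (hxy : ¬ x ≤ y)
    (hyx : ¬ y ≤ x) :
    φ x * φ y ∈ Submodule.span K ((fun m : StdMonomial P => monomialOf φ m.1) ''
      {m | ∃ w, IsGreatest (m.1.support : Set P) w ∧ x < w ∧ y < w}) := by
  refine Submodule.span_mono ?_ (hφ x y hxy hyx)
  rintro _ ⟨a, w, haw, hxw, hyw, rfl⟩
  exact ⟨.pair haw, ⟨w, StdMonomial.isGreatest_support_pair haw, hxw, hyw⟩,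
    monomialOf_single_add_single φ a w⟩

end CommSemiring

theorem isASLOnOp {K : Type*} [Field K] [Algebra K R] {φ : P → R}
    (hφ : HasQuadraticStraightening K φ)
    (hli : LinearIndependent K fun m : StdMonomial P => monomialOf φ m.1)
    (hspan : Submodule.span K (Set.range fun m : StdMonomial P => monomialOf φ m.1) = ⊤) :
    IsASLOnOp K φ where
  injective x y h := StdMonomial.of_injective <| hli.injective <| by
    simpa only [StdMonomial.of, monomialOf_single] using h
  linearIndependent := hli
  span_eq_top := hspan
  straightening x y hxy hyx r hr m hm := by
    obtain ⟨s, hs, hsr⟩ := (Finsupp.mem_span_image_iff_linearCombination K).1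
      (hφ.mul_mem_span_isGreatest hxy hyx)
    obtain rfl : r = s := hli ((hsr.trans hr).symm)
    exact (Finsupp.mem_supported K r).1 hs (Finsupp.mem_support_iff.2 hm)

/-- The standard monomials span `K[P] / J` and remain independent in `R`, so that the
map `K[P] / J → R` is injective. -/
theorem ker_aeval_eq {K : Type*} [CommRing K] [Algebra K R] {φ : P → R} [Finite P]
    {J : Ideal (MvPolynomial P K)}
    (hJ : HasQuadraticStraightening K fun x => Ideal.Quotient.mk J (X x))
    (hle : J ≤ RingHom.ker (aeval φ : MvPolynomial P K →ₐ[K] R))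
    (hli : LinearIndependent K fun m : StdMonomial P => monomialOf φ m.1) :
    RingHom.ker (aeval φ : MvPolynomial P K →ₐ[K] R) = J := by
  refine le_antisymm (fun f hf => ?_) hle
  let ψ : P → MvPolynomial P K ⧸ J := fun x => Ideal.Quotient.mk J (X x)
  have hmk : Ideal.Quotient.mkₐ K J = aeval ψ :=
    MvPolynomial.algHom_ext fun x => (aeval_X ψ x).symm
  let g : MvPolynomial P K ⧸ J →ₐ[K] R := Ideal.Quotient.liftₐ J (aeval φ) hle
  have hgψ : ∀ x, g (ψ x) = φ x := fun x => aeval_X φ x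
  obtain ⟨r, hr⟩ := Finsupp.mem_span_range_iff_exists_finsupp.1 (hJ.aeval_mem_span f)
  rw [← hmk] at hr
  have hgf : r.sum (fun m c => c • monomialOf φ m.1) = 0 := by
    have := congrArg g hr
    simp only [map_finsuppSum, map_smul, map_monomialOf] at this
    simpa only [ψ, hgψ] using this.trans hf
  rw [linearIndependent_iff.1 hli r hgf, Finsupp.sum_zero_index] at hr
  exact Ideal.Quotient.eq_zero_iff_mem.1 hr.symm

end HasQuadraticStraightening

end Straightening

section HibiRing

theorem monomialOf_addMonoidAlgebra_single (K : Type*) [CommRing K] {P M : Type*}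
    [AddCommMonoid M] (v : P → M) (m : P →₀ ℕ) :
    monomialOf (fun x => AddMonoidAlgebra.single (v x) (1 : K)) m =
      AddMonoidAlgebra.single (Finsupp.weight v m) 1 := by
  simp only [monomialOf, AddMonoidAlgebra.single_pow, one_pow, Finsupp.prod,
    AddMonoidAlgebra.prod_single, Finset.prod_const_one, Finsupp.weight_apply, Finsupp.sum]

/-- The exponent of `t ∏_{p ∈ e x} X_p`, the monomial by which Hibi's embedding of `K[L]` modulo
the straightening relations represents `x`, for a representation `e` of `L` by subsets of `S`. -/
noncomputable def hibiExponent {P S : Type*} (e : P → Set S) (x : P) : ℕ × (S → ℕ) :=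
  (1, (e x).indicator 1)

theorem hibiExponent_add {P S : Type*} {e : P → Set S} {x y m j : P} (hm : e m = e x ∩ e y)
    (hj : e j = e x ∪ e y) :
    hibiExponent e x + hibiExponent e y = hibiExponent e m + hibiExponent e j := by
  refine Prod.ext rfl ?_
  simp only [hibiExponent, Prod.snd_add, hm, hj]
  rw [add_comm (Set.indicator (_ ∩ _) _), Set.indicator_union_add_inter]

theorem weight_hibiExponent_eq_zero_iff {P S : Type*} (e : P → Set S) {m : P →₀ ℕ} :
    Finsupp.weight (hibiExponent e) m = 0 ↔ m = 0 := by
  refine ⟨fun h => (Finsupp.degree_eq_zero_iff m).1 ?_, fun h => by rw [h, map_zero]⟩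
  simpa [Finsupp.weight_apply, Finsupp.sum, hibiExponent, Prod.fst_sum, Finsupp.degree_apply]
    using congrArg Prod.fst h

theorem weight_hibiExponent_snd_ne_zero_iff {P S : Type*} (e : P → Set S) (m : P →₀ ℕ) {p : S} :
    (Finsupp.weight (hibiExponent e) m).2 p ≠ 0 ↔ ∃ x ∈ m.support, p ∈ e x := by
  simp [Finsupp.weight_apply, Finsupp.sum, hibiExponent, Prod.snd_sum, Finset.sum_apply,
    Finset.sum_eq_zero_iff]

variable {P : Type*} [PartialOrder P]

theorem setOf_weight_hibiExponent_ne_zero {S : Type*} (e : P ↪o Set S) {m : P →₀ ℕ} {w : P}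
    (hw : IsGreatest (m.support : Set P) w) :
    {p | (Finsupp.weight (hibiExponent e) m).2 p ≠ 0} = e w :=
  Set.ext fun _ => (weight_hibiExponent_snd_ne_zero_iff e m).trans
    ⟨fun ⟨_, hx, hp⟩ => e.monotone (hw.2 hx) hp, fun hp => ⟨w, hw.1, hp⟩⟩

/-- The greatest element `w` of a multichain is read off its weight, since `e w` is the set of the
variables that occur; remove it and continue. -/
theorem eq_of_weight_hibiExponent_eq {S : Type*} (e : P ↪o Set S) {m n : P →₀ ℕ}
    (hm : IsChain (· ≤ ·) (m.support : Set P)) (hn : IsChain (· ≤ ·) (n.support : Set P))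
    (h : Finsupp.weight (hibiExponent e) m = Finsupp.weight (hibiExponent e) n) : m = n := by
  induction hd : m.degree generalizing m n with
  | zero =>
    obtain rfl := (Finsupp.degree_eq_zero_iff m).1 hd
    rw [map_zero, eq_comm, weight_hibiExponent_eq_zero_iff] at h
    exact h.symm
  | succ d ih =>
    have hm0 : m ≠ 0 := by rintro rfl; simp at hd
    have hn0 : n ≠ 0 := by
      rwa [← (weight_hibiExponent_eq_zero_iff e).ne, ← h, (weight_hibiExponent_eq_zero_iff e).ne]
    obtain ⟨w, hw⟩ := StdMonomial.exists_isGreatest hm hm0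
    obtain ⟨w', hw'⟩ := StdMonomial.exists_isGreatest hn hn0
    obtain rfl : w = w' := e.injective <| by
      rw [← setOf_weight_hibiExponent_ne_zero e hw, h, setOf_weight_hibiExponent_ne_zero e hw']
    obtain ⟨m', rfl⟩ := exists_eq_add_single_one hw.1
    obtain ⟨n', rfl⟩ := exists_eq_add_single_one hw'.1
    have hsub : ∀ k : P →₀ ℕ, (k.support : Set P) ⊆ (k + Finsupp.single w 1).support := fun k =>
      Finset.coe_subset.2 (Finsupp.support_mono le_self_add)
    rw [ih (hm.mono (hsub m')) (hn.mono (hsub n')) ?_ ?_]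
    · simpa only [map_add, add_left_inj] using h
    · simpa using hd

theorem exists_orderEmbedding_set.{u} (L : Type u) [DistribLattice L] :
    ∃ (S : Type u) (e : L ↪o Set S),
      ∀ x y, e (x ⊓ y) = e x ∩ e y ∧ e (x ⊔ y) = e x ∪ e y := by
  let e : L → Set {J : Order.Ideal L // J.IsPrime} := fun x => {J | x ∉ J.1}
  have hle : ∀ x y, e x ≤ e y ↔ x ≤ y := fun x y => by
    refine ⟨fun h => ?_, fun h J hx hy => hx (J.1.lower h hy)⟩
    by_contra hxy
    obtain ⟨J, hJ, hyJ, hxJ⟩ := DistribLattice.prime_ideal_of_disjoint_filter_ideal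
      (F := Order.PFilter.principal x) (I := Order.Ideal.principal y)
      (Set.disjoint_left.2 fun u hu hu' => hxy (le_trans hu hu'))
    exact h (a := ⟨J, hJ⟩) (fun hx => Set.disjoint_left.1 hxJ (le_refl x) hx)
      (hyJ (Order.Ideal.mem_principal_self))
  refine ⟨_, OrderEmbedding.ofMapLEIff e hle, fun x y => ⟨Set.ext fun J => ?_, Set.ext fun J => ?_⟩⟩
  · have : x ⊓ y ∈ J.1 ↔ x ∈ J.1 ∨ y ∈ J.1 :=
      ⟨J.2.mem_or_mem, fun h => h.elim (J.1.lower inf_le_left) (J.1.lower inf_le_right)⟩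
    simp [e, this]
  · simp [e, Order.Ideal.sup_mem_iff, or_iff_not_imp_left]

theorem linearIndependent_hibiRing (K : Type*) [Field K] (L : Type*) [DistribLattice L] :
    LinearIndependent K fun m : StdMonomial L =>
      monomialOf (fun x => Ideal.Quotient.mk (hibiIdeal K L) (X x)) m.1 := by
  obtain ⟨S, e, he⟩ := exists_orderEmbedding_set L
  let u : L → AddMonoidAlgebra K (ℕ × (S → ℕ)) := fun x => .single (hibiExponent e x) 1
  have hu : hibiIdeal K L ≤ RingHom.ker (aeval u : MvPolynomial L K →ₐ[K] _) := by
    refine Ideal.span_le.2 ?_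
    rintro _ ⟨x, y, m, j, hm, hj, rfl⟩
    obtain rfl := hm.unique isGLB_pair
    obtain rfl := hj.unique isLUB_pair
    change aeval u _ = 0
    simp only [u, map_sub, map_mul, aeval_X, AddMonoidAlgebra.single_mul_single,
      hibiExponent_add (he x y).1 (he x y).2, sub_self]
  let g : HibiRing K L →ₐ[K] AddMonoidAlgebra K (ℕ × (S → ℕ)) :=
    Ideal.Quotient.liftₐ _ (aeval u) hu
  have hg : ∀ x, g (Ideal.Quotient.mk _ (X x)) = u x := fun x => aeval_X u x
  have hval : (g.toLinearMap ∘ fun m : StdMonomial L =>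
      monomialOf (fun x => Ideal.Quotient.mk (hibiIdeal K L) (X x)) m.1) =
      AddMonoidAlgebra.basis _ K ∘ fun m => Finsupp.weight (hibiExponent e) m.1 := by
    funext m
    simp only [Function.comp_apply, AlgHom.toLinearMap_apply, map_monomialOf, hg, u,
      monomialOf_addMonoidAlgebra_single, AddMonoidAlgebra.basis_apply]
  refine .of_comp g.toLinearMap ?_
  rw [hval]
  exact (AddMonoidAlgebra.basis _ K).linearIndependent.comp _ fun m n h =>
    Subtype.ext (eq_of_weight_hibiExponent_eq e m.2 n.2 h)

end HibiRing

namespace PosetAlgebra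

variable {K : Type*} [Field K] {P : Type*} [PartialOrder P] (T : PosetAlgebra K P)

/-- The projection of `lim_P T` to the stalk at `z`. -/
def proj (z : P) : T.lim →ₐ[K] T.stalk z :=
  (Pi.evalAlgHom K T.stalk z).comp T.lim.val

variable {T} in
theorem lim_ext {s t : T.lim} (h : ∀ z, T.proj z s = T.proj z t) : s = t :=
  Subtype.ext (funext h)

theorem res_proj {z' z : P} (h : z' ≤ z) (s : T.lim) : T.res h (T.proj z s) = T.proj z' s :=
  s.2 z' z h

section Grading

noncomputable local instance (z : P) : GradedAlgebra (T.grading z) := (T.graded z).some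

theorem gradedMonoid_limGrading : SetLike.GradedMonoid T.limGrading where
  one_mem x := SetLike.GradedOne.one_mem (A := T.grading x)
  mul_mem _ _ _ _ ha hb x := SetLike.GradedMul.mul_mem (ha x) (hb x)

/-- The homogeneous component of degree `d` of a section, taken stalk by stalk. -/
noncomputable def limComponent (d : ℤ) (s : T.lim) : T.lim :=
  ⟨fun z => DirectSum.decompose (T.grading z) (T.proj z s) d, fun x y h => by
    let f : T.grading y →+*ᵍ T.grading x := ⟨T.res h, T.res_mem h _ _⟩
    exact f.map_directSumDecompose.trans <|
      congrArg (fun s => (DirectSum.decompose (T.grading x) s d : T.stalk x)) (T.res_proj h s)⟩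

theorem proj_limComponent (d : ℤ) (s : T.lim) (z : P) :
    T.proj z (T.limComponent d s) = DirectSum.decompose (T.grading z) (T.proj z s) d :=
  rfl

theorem limComponent_mem (d : ℤ) (s : T.lim) : T.limComponent d s ∈ T.limGrading d :=
  fun _ => SetLike.coe_mem _

theorem iSupIndep_limGrading : iSupIndep T.limGrading := by
  intro d
  rw [Submodule.disjoint_def]
  refine fun a ha ha' => lim_ext fun z => ?_
  have hind := (DirectSum.Decomposition.isInternal (T.grading z)).submodule_iSupIndep d
  have hle : (⨆ (e) (_ : e ≠ d), T.limGrading e) ≤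
      (⨆ (e) (_ : e ≠ d), T.grading z e).comap (T.proj z).toLinearMap :=
    iSup₂_le fun e he b hb => Submodule.mem_iSup_of_mem e (Submodule.mem_iSup_of_mem he (hb z))
  rw [map_zero]
  exact Submodule.disjoint_def.1 hind _ (ha z) (hle ha')

theorem exists_sum_limComponent_eq [Finite P] (s : T.lim) :
    ∃ D : Finset ℤ, ∑ d ∈ D, T.limComponent d s = s := by
  classical
  have := Fintype.ofFinite P
  let D : P → Finset ℤ := fun z => (DirectSum.decompose (T.grading z) (T.proj z s)).support
  refine ⟨Finset.univ.biUnion D, lim_ext fun z => ?_⟩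
  have hD : D z ⊆ Finset.univ.biUnion D := Finset.subset_biUnion_of_mem D (Finset.mem_univ z)
  simp only [map_sum, proj_limComponent]
  rw [← Finset.sum_subset hD fun d _ hd => ?_]
  · exact DirectSum.sum_support_decompose _ _
  · rw [DFinsupp.notMem_support_iff.1 hd, ZeroMemClass.coe_zero]

theorem isInternal_limGrading [Finite P] : DirectSum.IsInternal T.limGrading := by
  refine (DirectSum.isInternal_submodule_iff_iSupIndep_and_iSup_eq_top _).2
    ⟨T.iSupIndep_limGrading, eq_top_iff.2 fun s _ => ?_⟩
  obtain ⟨D, hD⟩ := T.exists_sum_limComponent_eq s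
  rw [← hD]
  exact Submodule.sum_mem _ fun d _ => Submodule.mem_iSup_of_mem d (T.limComponent_mem d s)

theorem nonempty_gradedAlgebra_limGrading [Finite P] : Nonempty (GradedAlgebra T.limGrading) :=
  have := T.gradedMonoid_limGrading
  ⟨T.isInternal_limGrading.gradedAlgebra⟩

end Grading

/-- The projections of the sections `v i` with `t i ≤ z` form a basis of the stalk at `z`, and the
other sections vanish there. -/
structure IsStalkwiseBasis {T : PosetAlgebra K P} {ι : Type*} (t : ι → P) (v : ι → T.lim) :
    Prop where
  proj_eq_zero : ∀ i z, ¬ t i ≤ z → T.proj z (v i) = 0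
  linearIndepOn : ∀ z, LinearIndepOn K (fun i => T.proj z (v i)) {i | t i ≤ z}
  span_eq_top : ∀ z, Submodule.span K (Set.range fun i => T.proj z (v i)) = ⊤

variable {T} {ι : Type*}

theorem proj_linearCombination (z : P) (v : ι → T.lim) (f : ι →₀ K) :
    T.proj z (Finsupp.linearCombination K v f) =
      Finsupp.linearCombination K (fun i => T.proj z (v i)) f :=
  Finsupp.apply_linearCombination K (T.proj z).toLinearMap v f

namespace IsStalkwiseBasis

variable {t : ι → P} {v : ι → T.lim}

open Classical in
theorem linearCombination_filter (h : IsStalkwiseBasis t v) (z : P) (f : ι →₀ K) :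
    Finsupp.linearCombination K (fun i => T.proj z (v i)) (f.filter fun i => t i ≤ z) =
      Finsupp.linearCombination K (fun i => T.proj z (v i)) f := by
  nth_rw 2 [← f.filter_add_filter_not fun i => t i ≤ z]
  rw [map_add, left_eq_add, Finsupp.linearCombination_apply]
  refine Finset.sum_eq_zero fun i hi => ?_
  rw [Finsupp.support_filter, Finset.mem_filter] at hi
  simp only [h.proj_eq_zero i z hi.2, smul_zero]

theorem linearCombination_eq_iff (h : IsStalkwiseBasis t v) {z : P} {f g : ι →₀ K} :
    Finsupp.linearCombination K (fun i => T.proj z (v i)) f =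
      Finsupp.linearCombination K (fun i => T.proj z (v i)) g ↔ ∀ i, t i ≤ z → f i = g i := by
  classical
  have hmem : ∀ k : ι →₀ K,
      k.filter (fun i => t i ≤ z) ∈ Finsupp.supported K K {i | t i ≤ z} := fun k => by
    simp [Finsupp.mem_supported, Finsupp.support_filter]
  rw [← h.linearCombination_filter z f, ← h.linearCombination_filter z g]
  refine ⟨fun hfg i hi => ?_, fun hfg => ?_⟩
  · have := linearIndepOn_iffₛ.1 (h.linearIndepOn z) _ (hmem f) _ (hmem g) hfg
    simpa only [Finsupp.filter_apply_pos (fun i => t i ≤ z) _ hi] using DFunLike.congr_fun this i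
  · congr 1
    ext i
    simp only [Finsupp.filter_apply]
    split_ifs with hi
    exacts [hfg i hi, rfl]

theorem linearIndependent (h : IsStalkwiseBasis t v) : LinearIndependent K v :=
  fun f g hfg => Finsupp.ext fun i => h.linearCombination_eq_iff.1
    (by simpa only [proj_linearCombination] using congrArg (T.proj (t i)) hfg) i le_rfl

/-- The coefficient of `v i` in the expansion of a section over the stalk at `z ≥ t i` is the same
as over the stalk at `t i`; these coefficients expand the section in `lim_P T`. -/
theorem exists_linearCombination_eq [Finite P] (h : IsStalkwiseBasis t v) (s : T.lim) :
    ∃ q, Finsupp.linearCombination K v q = s := by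
  classical
  have := Fintype.ofFinite P
  have hr : ∀ z, ∃ r, Finsupp.linearCombination K (fun i => T.proj z (v i)) r = T.proj z s :=
    fun z => Finsupp.mem_span_range_iff_exists_finsupp.1 (h.span_eq_top z ▸ Submodule.mem_top)
  choose r hr using hr
  have hcompat : ∀ i z, t i ≤ z → r (t i) i = r z i := fun i z hz => by
    have : T.proj (t i) (Finsupp.linearCombination K v (r z)) = T.proj (t i) s := by
      rw [← T.res_proj hz, proj_linearCombination, hr, T.res_proj]
    rw [← hr, proj_linearCombination] at this
    exact (h.linearCombination_eq_iff.1 this i le_rfl).symm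
  let q : ι →₀ K := ∑ z, (r z).filter fun i => t i = z
  have hq : ∀ i, q i = r (t i) i := fun i => by
    simp [q, Finsupp.finsetSum_apply, Finsupp.filter_apply]
  refine ⟨q, lim_ext fun z => ?_⟩
  rw [proj_linearCombination, ← hr, h.linearCombination_eq_iff]
  exact fun i hi => (hq i).trans (hcompat i z hi)

theorem span_range_eq_top [Finite P] (h : IsStalkwiseBasis t v) :
    Submodule.span K (Set.range v) = ⊤ :=
  eq_top_iff.2 fun s _ => Finsupp.mem_span_range_iff_exists_finsupp.2
    (h.exists_linearCombination_eq s)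

end IsStalkwiseBasis

end PosetAlgebra

section Order

variable {P : Type*} [PartialOrder P]

theorem mem_minUpperBounds [Fintype P] {x y z : P} :
    z ∈ minUpperBounds x y ↔ Minimal (fun w => x ≤ w ∧ y ≤ w) z := by
  simp only [minUpperBounds, Finset.mem_filter_univ]

theorem bddAbove_of_mem_minUpperBounds [Fintype P] {x y z : P} (hz : z ∈ minUpperBounds x y) :
    BddAbove {x, y} :=
  ⟨z, by simpa [upperBounds_insert] using (mem_minUpperBounds.1 hz).prop⟩

theorem lt_of_mem_minUpperBounds [Fintype P] {x y z : P} (hxy : ¬ x ≤ y) (hyx : ¬ y ≤ x)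
    (hz : z ∈ minUpperBounds x y) : x < z ∧ y < z := by
  obtain ⟨⟨hxz, hyz⟩, -⟩ := mem_minUpperBounds.1 hz
  exact ⟨hxz.lt_of_ne fun h => hyx (h ▸ hyz), hyz.lt_of_ne fun h => hxy (h ▸ hxz)⟩

variable [OrderBot P]

theorem meet_eq_of_isGLB {x y m : P} (h : IsGLB {x, y} m) : meet x y = m := by
  have h' : ∃ m, IsGLB {x, y} m := ⟨m, h⟩
  rw [meet, dif_pos h']
  exact h'.choose_spec.unique h

theorem isGLB_of_Icc {w : P} {x y m : Set.Icc ⊥ w} (h : IsGLB {x, y} m) :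
    IsGLB {x.1, y.1} m.1 := by
  simp only [isGLB_iff_le_iff, lowerBounds_insert, lowerBounds_singleton] at h ⊢
  refine fun u => ⟨fun hu => (h ⟨u, bot_le, hu.trans m.2.2⟩).1 hu, fun hu => ?_⟩
  exact (h ⟨u, bot_le, hu.1.trans x.2.2⟩).2 hu

theorem le_iff_of_isLUB_Icc {w : P} {x y j : Set.Icc ⊥ w} (h : IsLUB {x, y} j) {u : P}
    (hu : u ≤ w) : j.1 ≤ u ↔ x.1 ≤ u ∧ y.1 ≤ u := by
  simp only [isLUB_iff_le_iff, upperBounds_insert, upperBounds_singleton] at h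
  exact h ⟨u, bot_le, hu⟩

theorem mem_minUpperBounds_iff_of_isLUB [Fintype P] {w : P} {x y j : Set.Icc ⊥ w}
    (h : IsLUB {x, y} j) {z : P} (hz : z ≤ w) : z ∈ minUpperBounds x.1 y.1 ↔ z = j.1 := by
  have hj := (le_iff_of_isLUB_Icc h j.2.2).1 le_rfl
  rw [mem_minUpperBounds]
  constructor
  · intro hm
    have hjz := (le_iff_of_isLUB_Icc h hz).2 hm.prop
    exact (hm.le_of_le hj hjz).antisymm hjz
  · rintro rfl
    exact ⟨hj, fun u hu huj => (le_iff_of_isLUB_Icc h (huj.trans hz)).2 hu⟩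

namespace IsLocallyDistributive

theorem exists_distribLattice_toPartialOrder_eq (hP : IsLocallyDistributive P) (w : P) :
    ∃ D : DistribLattice (Set.Icc ⊥ w),
      D.toSemilatticeInf.toPartialOrder = Subtype.partialOrder _ := by
  obtain ⟨D, hD⟩ := hP w
  exact ⟨D, PartialOrder.ext hD⟩

theorem exists_isGLB_isLUB (hP : IsLocallyDistributive P) {w : P} (x y : Set.Icc ⊥ w) :
    ∃ m j, IsGLB {x, y} m ∧ IsLUB {x, y} j := by
  obtain ⟨D, hD⟩ := hP.exists_distribLattice_toPartialOrder_eq w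
  have h : ∃ m j, @IsGLB _ D.toSemilatticeInf.toPartialOrder.toLE {x, y} m ∧
      @IsLUB _ D.toSemilatticeInf.toPartialOrder.toLE {x, y} j := ⟨_, _, isGLB_pair, isLUB_pair⟩
  rwa [hD] at h

theorem exists_isGLB (hP : IsLocallyDistributive P) {x y : P} (h : BddAbove {x, y}) :
    ∃ m, IsGLB {x, y} m := by
  obtain ⟨w, hw⟩ := h
  obtain ⟨m, -, hm, -⟩ := hP.exists_isGLB_isLUB (w := w) ⟨x, bot_le, hw (by simp)⟩
    ⟨y, bot_le, hw (by simp)⟩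
  exact ⟨m, isGLB_of_Icc hm⟩

theorem meet_le [Fintype P] (hP : IsLocallyDistributive P) {x y z : P}
    (hz : z ∈ minUpperBounds x y) : meet x y ≤ x := by
  obtain ⟨m, hm⟩ := hP.exists_isGLB (bddAbove_of_mem_minUpperBounds hz)
  rw [meet_eq_of_isGLB hm]
  exact hm.1 (Set.mem_insert x {y})

end IsLocallyDistributive

/-- The elements `φ x` of `R` satisfy the relations `x y = (x ∧ y) ∑ z`, the sum being over the
minimal upper bounds `z` of `x, y`. -/
def SatisfiesRelations [Fintype P] {R : Type*} [CommRing R] (φ : P → R) : Prop :=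
  ∀ x y, φ x * φ y = φ (meet x y) * ∑ z ∈ minUpperBounds x y, φ z

namespace SatisfiesRelations

variable [Fintype P] {R : Type*} [CommRing R]

theorem hasQuadraticStraightening (K : Type*) [CommSemiring K] [Algebra K R] {φ : P → R}
    (hφ : SatisfiesRelations φ) (hP : IsLocallyDistributive P) :
    HasQuadraticStraightening K φ := fun x y hxy hyx => by
  rw [hφ, Finset.mul_sum]
  refine Submodule.sum_mem _ fun z hz => Submodule.subset_span ?_
  obtain ⟨hxz, hyz⟩ := lt_of_mem_minUpperBounds hxy hyx hz
  exact ⟨_, z, (hP.meet_le hz).trans hxz.le, hxz, hyz, rfl⟩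

theorem iff_aeval_relation_eq_zero (K : Type*) [Field K] [Algebra K R] {φ : P → R} :
    SatisfiesRelations φ ↔ ∀ x y, aeval φ (relation K x y) = 0 := by
  simp only [SatisfiesRelations, relation, map_sub, map_mul, map_sum, aeval_X, sub_eq_zero]

end SatisfiesRelations

end Order

section Stalks

variable (K : Type*) [Field K] {P : Type*} [PartialOrder P] [OrderBot P]

theorem genFamily_of_le {x z : P} (h : x ≤ z) :
    genFamily K x z = Ideal.Quotient.mk _ (X ⟨x, bot_le, h⟩) :=
  dif_pos h

theorem genFamily_of_not_le {x z : P} (h : ¬ x ≤ z) : genFamily K x z = 0 :=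
  dif_neg h

theorem genFamily_coe {z : P} (x : Set.Icc ⊥ z) :
    genFamily K x.1 z = Ideal.Quotient.mk _ (X x) :=
  genFamily_of_le K x.2.2

/-- If `x, y ≤ w`, then the join of `x` and `y` in `[0_P, w]` is their only minimal upper bound
below `w`. -/
theorem satisfiesRelations_genFamily [Fintype P] (hP : IsLocallyDistributive P) (w : P) :
    SatisfiesRelations fun x => genFamily K x w := fun x y => by
  by_cases h : x ≤ w ∧ y ≤ w
  · lift x to Set.Icc ⊥ w using ⟨bot_le, h.1⟩
    lift y to Set.Icc ⊥ w using ⟨bot_le, h.2⟩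
    obtain ⟨m, j, hm, hj⟩ := hP.exists_isGLB_isLUB x y
    have hsum : ∑ z ∈ minUpperBounds x.1 y.1, genFamily K z w = genFamily K j.1 w :=
      Finset.sum_eq_single_of_mem j.1 ((mem_minUpperBounds_iff_of_isLUB hj j.2.2).2 rfl)
        fun z hz hzj => genFamily_of_not_le K fun hzw =>
          hzj ((mem_minUpperBounds_iff_of_isLUB hj hzw).1 hz)
    simp only [hsum, meet_eq_of_isGLB (isGLB_of_Icc hm), genFamily_coe, ← map_mul]
    exact Ideal.Quotient.eq.2 (Ideal.subset_span ⟨_, _, _, _, hm, hj, rfl⟩)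
  · have hprod : genFamily K x w * genFamily K y w = 0 := by
      rcases not_and_or.1 h with h | h
      · rw [genFamily_of_not_le K h, zero_mul]
      · rw [genFamily_of_not_le K h, mul_zero]
    have hsum : ∑ z ∈ minUpperBounds x y, genFamily K z w = 0 := Finset.sum_eq_zero fun z hz => by
      obtain ⟨⟨hxz, hyz⟩, -⟩ := mem_minUpperBounds.1 hz
      exact genFamily_of_not_le K fun hzw => h ⟨hxz.trans hzw, hyz.trans hzw⟩
    simp only [hprod, hsum, mul_zero]

theorem aeval_genFamily_surjective (w : P) :
    Function.Surjective (aeval (fun x => genFamily K x w) :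
      MvPolynomial P K →ₐ[K] HibiRing K (Set.Icc ⊥ w)) := fun s => by
  obtain ⟨f, rfl⟩ := Ideal.Quotient.mk_surjective s
  have hmk : aeval ((fun x => genFamily K x w) ∘ Subtype.val) =
      Ideal.Quotient.mkₐ K (hibiIdeal K (Set.Icc ⊥ w)) :=
    MvPolynomial.algHom_ext fun x => (aeval_X _ x).trans (genFamily_coe K x)
  exact ⟨rename Subtype.val f, by rw [aeval_rename, hmk, Ideal.Quotient.mkₐ_eq_mk]⟩

theorem linearIndepOn_monomialOf_genFamily (hP : IsLocallyDistributive P) (w : P) :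
    LinearIndepOn K (fun m : StdMonomial P => monomialOf (fun x => genFamily K x w) m.1)
      {m | m.sup ≤ w} := by
  let e : Set.Icc ⊥ w ↪o P := OrderEmbedding.subtype _
  have hrange : {m : StdMonomial P | m.sup ≤ w} = Set.range (StdMonomial.map e) := by
    ext m
    simp only [Set.mem_ofPred_eq, StdMonomial.sup_le_iff, StdMonomial.mem_range_map_iff, e,
      OrderEmbedding.coe_subtype, Subtype.range_coe, Set.subset_def, Finset.mem_coe, Set.mem_Icc,
      bot_le, true_and]
  have hmap : (fun m : StdMonomial P => monomialOf (fun x => genFamily K x w) m.1) ∘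
      StdMonomial.map e = fun m =>
        monomialOf (fun x => Ideal.Quotient.mk (hibiIdeal K (Set.Icc ⊥ w)) (X x)) m.1 := by
    funext m
    exact (monomialOf_mapDomain _ e m.1).trans (by congr 1; exact funext (genFamily_coe K))
  rw [hrange, linearIndepOn_range_iff (StdMonomial.map_injective e), hmap]
  obtain ⟨D, hD⟩ := hP.exists_distribLattice_toPartialOrder_eq w
  have hli := @linearIndependent_hibiRing K _ _ D
  rwa [hD] at hli

theorem proj_gen (z x : P) : (hibiAlgebra K P).proj z (gen K x) = genFamily K x z := rfl

theorem proj_monomialOf_gen (z : P) (m : P →₀ ℕ) :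
    (hibiAlgebra K P).proj z (monomialOf (gen K) m) = monomialOf (fun x => genFamily K x z) m :=
  map_monomialOf _ _ _

theorem isStalkwiseBasis_monomialOf_gen [Finite P] (hP : IsLocallyDistributive P) :
    PosetAlgebra.IsStalkwiseBasis (T := hibiAlgebra K P) StdMonomial.sup
      fun m => monomialOf (gen K) m.1 where
  proj_eq_zero m z hz := by
    rw [StdMonomial.sup_le_iff] at hz
    push Not at hz
    obtain ⟨x, hx, hxz⟩ := hz
    rw [proj_monomialOf_gen]
    exact monomialOf_eq_zero hx (genFamily_of_not_le K hxz)
  linearIndepOn := by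
    simp only [proj_monomialOf_gen]
    exact linearIndepOn_monomialOf_genFamily K hP
  span_eq_top z := by
    have := Fintype.ofFinite P
    simp only [proj_monomialOf_gen]
    exact ((satisfiesRelations_genFamily K hP z).hasQuadraticStraightening K hP).span_eq_top
      (aeval_genFamily_surjective K z)

end Stalks

section Limit

variable (K : Type*) [Field K] {P : Type*} [PartialOrder P] [OrderBot P]

theorem gen_mem_limGrading (x : P) : gen K x ∈ (hibiAlgebra K P).limGrading 1 := fun z => by
  change genFamily K x z ∈ hibiGrading K (Set.Icc ⊥ z) 1
  by_cases h : x ≤ z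
  · rw [genFamily_of_le K h]
    exact ⟨_, isWeightedHomogeneous_X K _ _, rfl⟩
  · rw [genFamily_of_not_le K h]
    exact Submodule.zero_mem _

theorem satisfiesRelations_gen [Fintype P] (hP : IsLocallyDistributive P) :
    SatisfiesRelations (gen K : P → GenHibiRing K P) := fun x y =>
  PosetAlgebra.lim_ext fun w => by
    simp only [map_mul, map_sum, proj_gen]
    exact satisfiesRelations_genFamily K hP w x y

theorem isASLOnOp_gen [Finite P] (hP : IsLocallyDistributive P) :
    IsASLOnOp K (gen K : P → GenHibiRing K P) :=
  have := Fintype.ofFinite P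
  have hbasis := isStalkwiseBasis_monomialOf_gen K hP
  ((satisfiesRelations_gen K hP).hasQuadraticStraightening K hP).isASLOnOp
    hbasis.linearIndependent hbasis.span_range_eq_top

theorem ker_aeval_gen [Fintype P] (hP : IsLocallyDistributive P) :
    RingHom.ker (aeval (gen K) : MvPolynomial P K →ₐ[K] GenHibiRing K P) =
      Ideal.span {f | ∃ x y : P, f = relation K x y} := by
  have hrel : SatisfiesRelations fun x : P =>
      Ideal.Quotient.mkₐ K (Ideal.span {f | ∃ x y : P, f = relation K x y}) (X x) := by
    rw [SatisfiesRelations.iff_aeval_relation_eq_zero K]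
    intro x y
    rw [← MvPolynomial.comp_aeval_apply, aeval_X_left_apply]
    exact Ideal.Quotient.eq_zero_iff_mem.2 (Ideal.subset_span ⟨x, y, rfl⟩)
  refine (hrel.hasQuadraticStraightening K hP).ker_aeval_eq (Ideal.span_le.2 ?_)
    (isASLOnOp_gen K hP).linearIndependent
  rintro _ ⟨x, y, rfl⟩
  exact (SatisfiesRelations.iff_aeval_relation_eq_zero K).1 (satisfiesRelations_gen K hP) x y

theorem relation_eq_X_mul_X [Fintype P] {x y : P} (h : ¬ BddAbove {x, y}) :
    relation K x y = X x * X y := by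
  have : minUpperBounds x y = ∅ := Finset.eq_empty_of_forall_notMem fun z hz =>
    h (bddAbove_of_mem_minUpperBounds hz)
  rw [relation, this, Finset.sum_empty, mul_zero, sub_zero]

theorem stanleyIdeal_eq [Fintype P] (hP : IsLocallyDistributive P) :
    stanleyIdeal K P = Ideal.span {f | ∃ x y : P, f = relation K x y} := by
  refine congrArg Ideal.span (Set.ext fun f => ⟨?_, ?_⟩)
  · rintro (⟨x, y, h, rfl⟩ | ⟨x, y, m, -, hm, rfl⟩)
    · exact ⟨x, y, (relation_eq_X_mul_X K h).symm⟩
    · exact ⟨x, y, by rw [relation, meet_eq_of_isGLB hm]⟩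
  · rintro ⟨x, y, rfl⟩
    by_cases h : BddAbove {x, y}
    · obtain ⟨m, hm⟩ := hP.exists_isGLB h
      exact Or.inr ⟨x, y, m, h, hm, by rw [relation, meet_eq_of_isGLB hm]⟩
    · exact Or.inl ⟨x, y, h, relation_eq_X_mul_X K h⟩

end Limit

namespace IsASLOnOp

variable {K : Type*} [Field K] {P : Type*} [PartialOrder P] {R S : Type*} [CommRing R]
  [Algebra K R] [CommRing S] [Algebra K S] {φ : P → R}

theorem aeval_surjective (h : IsASLOnOp K φ) :
    Function.Surjective (aeval φ : MvPolynomial P K →ₐ[K] R) := by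
  rw [← AlgHom.coe_toLinearMap, ← LinearMap.range_eq_top, eq_top_iff, ← h.span_eq_top,
    Submodule.span_le]
  rintro _ ⟨m, rfl⟩
  exact ⟨monomial m.1 1, aeval_monomial_one φ m.1⟩

theorem map_algEquiv (h : IsASLOnOp K φ) (e : R ≃ₐ[K] S) : IsASLOnOp K fun x => e (φ x) where
  injective := e.injective.comp h.injective
  linearIndependent := by
    simp only [← map_monomialOf]
    exact h.linearIndependent.map' e.toLinearMap (LinearMap.ker_eq_bot.2 e.injective)
  span_eq_top := by
    have := congrArg (Submodule.map e.toLinearMap) h.span_eq_top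
    rw [Submodule.map_span, ← Set.range_comp, Submodule.map_top,
      LinearMap.range_eq_top.2 e.surjective] at this
    simp only [← map_monomialOf]
    exact this
  straightening x y hxy hyx r hr := by
    refine h.straightening x y hxy hyx r (e.injective ?_)
    rw [map_mul, hr, map_finsuppSum]
    simp only [map_smul, map_monomialOf]

end IsASLOnOp

theorem exists_algEquiv_stanleyRing (K : Type*) [Field K] {P : Type*} [PartialOrder P] [OrderBot P]
    [Fintype P] (hP : IsLocallyDistributive P) :
    ∃ e : GenHibiRing K P ≃ₐ[K] StanleyRing K P,
      ∀ x : P, e (gen K x) = Ideal.Quotient.mk (stanleyIdeal K P) (X x) := by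
  let e₁ := Ideal.quotientKerAlgEquivOfSurjective (isASLOnOp_gen K hP).aeval_surjective
  let e₂ := Ideal.quotientEquivAlgOfEq K ((stanleyIdeal_eq K hP).trans (ker_aeval_gen K hP).symm)
  refine ⟨(e₂.trans e₁).symm, fun x => ?_⟩
  rw [AlgEquiv.symm_apply_eq]
  exact (aeval_X (gen K) x).symm

end GenHibi

theorem corollary4p3_general {K : Type*} [Field K] {P : Type*} [PartialOrder P] [OrderBot P]
    [Fintype P] (hP : GenHibi.IsLocallyDistributive P) :
    GenHibi.IsGradedASLOnOp K (GenHibi.hibiAlgebra K P).limGrading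
      (GenHibi.gen K : P → GenHibi.GenHibiRing K P) ∧
    (∀ x : P, GenHibi.gen K x ∈ (GenHibi.hibiAlgebra K P).limGrading 1) ∧
    Function.Surjective
      (MvPolynomial.aeval (GenHibi.gen K) : MvPolynomial P K →ₐ[K] GenHibi.GenHibiRing K P) ∧
    RingHom.ker
      (MvPolynomial.aeval (GenHibi.gen K) : MvPolynomial P K →ₐ[K] GenHibi.GenHibiRing K P) =
      Ideal.span {f | ∃ x y : P, f = GenHibi.relation K x y} ∧
    GenHibi.IsASLOnOp K
      (fun x : P => Ideal.Quotient.mk (GenHibi.stanleyIdeal K P) (MvPolynomial.X x)) ∧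
    ∃ e : GenHibi.GenHibiRing K P ≃ₐ[K] GenHibi.StanleyRing K P,
      ∀ x : P, e (GenHibi.gen K x) =
        Ideal.Quotient.mk (GenHibi.stanleyIdeal K P) (MvPolynomial.X x) := by
  have hASL := GenHibi.isASLOnOp_gen K hP
  obtain ⟨e, he⟩ := GenHibi.exists_algEquiv_stanleyRing K hP
  refine ⟨⟨hASL, (GenHibi.hibiAlgebra K P).nonempty_gradedAlgebra_limGrading,
      fun x => ⟨1, one_pos, GenHibi.gen_mem_limGrading K x⟩⟩,
    GenHibi.gen_mem_limGrading K, hASL.aeval_surjective, GenHibi.ker_aeval_gen K hP, ?_, e, he⟩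
  simpa only [he] using hASL.map_algEquiv e

theorem corollary4p3 {K : Type*} [Field K] {P : Type*} [PartialOrder P] [OrderBot P] [Fintype P]
    (hP : GenHibi.IsLocallyDistributive P) :
    -- `lim_P T` is a `ℤ`-graded ASL on `P^op`, all elements of `P` having degree `1`
    GenHibi.IsGradedASLOnOp K (GenHibi.hibiAlgebra K P).limGrading
      (GenHibi.gen K : P → GenHibi.GenHibiRing K P) ∧
    (∀ x : P, GenHibi.gen K x ∈ (GenHibi.hibiAlgebra K P).limGrading 1) ∧
    -- `lim_P T = K[P] / I_T`, where `I_T` is generated by the listed relations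
    Function.Surjective
      (MvPolynomial.aeval (GenHibi.gen K) : MvPolynomial P K →ₐ[K] GenHibi.GenHibiRing K P) ∧
    RingHom.ker
      (MvPolynomial.aeval (GenHibi.gen K) : MvPolynomial P K →ₐ[K] GenHibi.GenHibiRing K P) =
      Ideal.span {f | ∃ x y : P, f = GenHibi.relation K x y} ∧
    -- for simplicial posets it is Stanley's ring, with the same ASL structure
    (GenHibi.IsSimplicialPoset P →
      GenHibi.IsASLOnOp K
        (fun x : P => Ideal.Quotient.mk (GenHibi.stanleyIdeal K P) (MvPolynomial.X x)) ∧
      ∃ e : GenHibi.GenHibiRing K P ≃ₐ[K] GenHibi.StanleyRing K P,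
        ∀ x : P, e (GenHibi.gen K x) =
          Ideal.Quotient.mk (GenHibi.stanleyIdeal K P) (MvPolynomial.X x)) := by
  obtain ⟨hASL, hdeg, hsurj, hker, hStanley⟩ := corollary4p3_general (K := K) hP
  exact ⟨hASL, hdeg, hsurj, hker, fun _ => hStanley⟩
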